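/- Let $G$ be a semitopological semigroup (a semigroup with a topology for which multiplication is separately continuous) that is right amenable, i.e. the space $C_b(G)$ of bounded continuous complex functions carries a linear functional $m$ with $m(\mathbf 1)=\|m\|=1$ and $m(R_gf)=m(f)$ for all $g\in G$, $f\in C_b(G)$, where $R_gf(h)=f(hg)$. Let $G$ act on a compact Hausdorff space $K$, i.e. let $G\times K\to K$, $(g,x)\mapsto gx$, be a continuous map with $(g_1g_2)x=g_1(g_2x)$. Call an action of $G$ on a compact Hausdorff space uniquely ergodic if there is exactly one $G$-invariant regular Borel probability measure on that space, and call it ergodic with respect to an invariant measure $\rho$ if every Borel set $A$ with $\rho(g^{-1}A\,\triangle\,A)=0$ for all $g\in G$ satisfies $\rho(A)=0$ or $\rho(A^c)=0$, where $g^{-1}A=\{x: gx\in A\}$. Suppose that the action of $G$ on $K$ is uniquely ergodic with invariant measure $\mu$. Let $\Omega$ be a compact Hausdorff group with normalized Haar measure $\eta$, and let $\gamma:G\times K\to\Omega$ be a continuous cocycle, i.e. a continuous map with $\gamma(g_1g_2,x)=\gamma(g_2,x)\,\gamma(g_1,g_2x)$ for all $g_1,g_2\in G$, $x\in K$. Let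 $\mu\times\eta$ denote the product measure, as a regular Borel measure on $K\times\Omega$. If the skew product action $$(g,(x,\omega))\mapsto (gx,\omega\gamma(g,x))$$ of $G$ on $K\times\Omega$ is ergodic with respect to $\mu\times\eta$, then it is uniquely ergodic (with invariant measure $\mu\times\eta$). -/

import Mathlib

open MeasureTheory Filter Topology
open scoped BoundedContinuousFunction CompactlySupported

/-! ### Right amenable semitopological semigroups -/

/-- For a bounded continuous function `f` on a semitopological semigroup, the right translate
`h ↦ f (h * g)`. -/
noncomputable def rightTranslate {G : Type*} [Semigroup G] [TopologicalSpace G]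
    [SeparatelyContinuousMul G] (g : G) (f : G →ᵇ ℂ) : G →ᵇ ℂ :=
  f.compContinuous ⟨fun h => h * g, continuous_mul_const g⟩

/-- A semitopological semigroup is right amenable if the space of bounded continuous
complex functions on it carries a right invariant mean. -/
def IsRightAmenable (G : Type*) [Semigroup G] [TopologicalSpace G]
    [SeparatelyContinuousMul G] : Prop :=
  ∃ m : (G →ᵇ ℂ) →L[ℂ] ℂ, m 1 = 1 ∧ ‖m‖ = 1 ∧
    ∀ (g : G) (f : G →ᵇ ℂ), m (rightTranslate g f) = m f

/-! ### Ergodicity and unique ergodicity -/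

/-- `μ` is a regular Borel probability measure that is invariant under the action of `G`. -/
structure IsInvariantProbability (G : Type*) {X : Type*} [SMul G X] [TopologicalSpace X]
    [MeasurableSpace X] (μ : Measure X) : Prop where
  isProbabilityMeasure : IsProbabilityMeasure μ
  regular : μ.Regular
  invariant : SMulInvariantMeasure G X μ

/-- The action of `G` on `X` is uniquely ergodic with invariant measure `μ`: among the regular
Borel probability measures on `X`, `μ` is the unique invariant one. -/
structure IsUniquelyErgodic (G : Type*) {X : Type*} [SMul G X] [TopologicalSpace X]
    [MeasurableSpace X] (μ : Measure X) : Prop where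
  isInvariantProbability : IsInvariantProbability G μ
  unique : ∀ ν : Measure X, IsInvariantProbability G ν → ν = μ

/-- The action of `G` on `X` is ergodic with respect to `μ`: every measurable set which is
invariant under each `g : G` up to a `μ`-null set is null or conull. -/
def IsErgodicAction (G : Type*) {X : Type*} [SMul G X] [MeasurableSpace X]
    (μ : Measure X) : Prop :=
  ∀ A : Set X, MeasurableSet A → (∀ g : G, (fun x => g • x) ⁻¹' A =ᵐ[μ] A) →
    μ A = 0 ∨ μ Aᶜ = 0

/-- For an invariant measure this is Mathlib's notion of an ergodic action. -/
theorem isErgodicAction_iff_ergodicSMul (G : Type*) {X : Type*} [SMul G X] [MeasurableSpace X]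
    (μ : Measure X) [SMulInvariantMeasure G X μ] :
    IsErgodicAction G μ ↔ ErgodicSMul G X μ := by
  have key : ∀ A : Set X, EventuallyConst A (ae μ) ↔ (μ A = 0 ∨ μ Aᶜ = 0) := by
    intro A
    rw [eventuallyConst_set', ae_eq_empty, ae_eq_univ]
  constructor
  · intro h
    exact ⟨fun hA hg => (key _).2 (h _ hA hg)⟩
  · intro h A hA hg
    exact (key A).1 (h.aeconst_of_forall_preimage_smul_ae_eq hA hg)

/-! ### The product of two Borel measures on compact spaces, as a regular Borel measure -/

theorem integrable_slice {X Y : Type*} [TopologicalSpace X] [TopologicalSpace Y]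
    [CompactSpace Y] [MeasurableSpace Y] [BorelSpace Y] (ν : Measure Y) [IsFiniteMeasure ν] (f : C(X × Y, ℝ)) (x : X) :
    Integrable (fun y => f (x, y)) ν :=
  Continuous.integrable_of_hasCompactSupport (by fun_prop) (HasCompactSupport.of_compactSpace _)

theorem continuous_integral_slice {X Y : Type*} [TopologicalSpace X]
    [TopologicalSpace Y] [CompactSpace Y] [MeasurableSpace Y] [BorelSpace Y] (ν : Measure Y) [IsFiniteMeasure ν] (f : C(X × Y, ℝ)) :
    Continuous fun x => ∫ y, f (x, y) ∂ν := by
  have h : LipschitzWith (ν.real Set.univ).toNNReal fun g : C(Y, ℝ) => ∫ y, g y ∂ν := by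
    refine LipschitzWith.of_dist_le_mul fun g k => ?_
    have hi : ∀ g : C(Y, ℝ), Integrable (fun y => g y) ν := fun g =>
      g.continuous.integrable_of_hasCompactSupport (HasCompactSupport.of_compactSpace _)
    rw [dist_eq_norm, ← integral_sub (hi g) (hi k), Real.coe_toNNReal _ measureReal_nonneg,
      mul_comm, dist_eq_norm]
    exact norm_integral_le_of_norm_le_const (ae_of_all _ fun y => (g - k).norm_coe_le_norm y)
  exact h.continuous.comp f.curry.continuous

section RadonProduct

variable {X Y : Type*} [TopologicalSpace X] [CompactSpace X] [T2Space X] [MeasurableSpace X]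
  [BorelSpace X] [TopologicalSpace Y] [CompactSpace Y] [T2Space Y] [MeasurableSpace Y]
  [BorelSpace Y]

theorem integrable_integral_slice (μ : Measure X) [IsFiniteMeasure μ] (ν : Measure Y)
    [IsFiniteMeasure ν] (f : C(X × Y, ℝ)) : Integrable (fun x => ∫ y, f (x, y) ∂ν) μ :=
  (continuous_integral_slice ν f).integrable_of_hasCompactSupport
    (HasCompactSupport.of_compactSpace _)

/-- The positive functional `f ↦ ∫ x, ∫ y, f (x, y) ∂ν ∂μ` on the continuous functions on
`X × Y`. -/
noncomputable def iteratedIntegral (μ : Measure X) [IsFiniteMeasure μ] (ν : Measure Y)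
    [IsFiniteMeasure ν] : C_c(X × Y, ℝ) →ₚ[ℝ] ℝ where
  toFun f := ∫ x, ∫ y, f (x, y) ∂ν ∂μ
  map_add' f g := by
    have h1 : ∀ x, ∫ y, (f + g) (x, y) ∂ν = ∫ y, f (x, y) ∂ν + ∫ y, g (x, y) ∂ν := fun x =>
      integral_add (integrable_slice ν f.toContinuousMap x)
        (integrable_slice ν g.toContinuousMap x)
    simp_rw [h1]
    exact integral_add (integrable_integral_slice μ ν f.toContinuousMap)
      (integrable_integral_slice μ ν g.toContinuousMap)
  map_smul' c f := by
    simp [integral_const_mul]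
  monotone' f g hfg := by
    refine integral_mono (integrable_integral_slice μ ν f.toContinuousMap)
      (integrable_integral_slice μ ν g.toContinuousMap) fun x => ?_
    exact integral_mono (integrable_slice ν f.toContinuousMap x)
      (integrable_slice ν g.toContinuousMap x) fun y => hfg (x, y)

/-- The product measure of `μ` and `ν` as a regular Borel measure on `X × Y`: the measure that
represents the functional `iteratedIntegral μ ν`. The Borel sigma-algebra of `X × Y` is given
explicitly, since it can be larger than the product sigma-algebra if the spaces are not
metrizable. -/
noncomputable def radonProd (μ : Measure X) [IsFiniteMeasure μ] (ν : Measure Y)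
    [IsFiniteMeasure ν] : @Measure (X × Y) (borel (X × Y)) :=
  letI : MeasurableSpace (X × Y) := borel (X × Y)
  haveI : BorelSpace (X × Y) := ⟨rfl⟩
  RealRMK.rieszMeasure (iteratedIntegral μ ν)

/-- The product measure is a regular Borel measure. -/
theorem radonProd_regular (μ : Measure X) [IsFiniteMeasure μ] (ν : Measure Y)
    [IsFiniteMeasure ν] :
    @Measure.Regular (X × Y) (borel (X × Y)) _ (radonProd μ ν) := by
  let _ : MeasurableSpace (X × Y) := borel (X × Y)
  have : BorelSpace (X × Y) := ⟨rfl⟩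
  exact RealRMK.regular_rieszMeasure (iteratedIntegral μ ν)

/-- Integration of continuous functions against the product measure is iterated integration. -/
theorem integral_radonProd (μ : Measure X) [IsFiniteMeasure μ] (ν : Measure Y)
    [IsFiniteMeasure ν] (f : C(X × Y, ℝ)) :
    @integral (X × Y) ℝ _ _ (borel (X × Y)) (radonProd μ ν) (fun p => f p) =
      ∫ x, ∫ y, f (x, y) ∂ν ∂μ := by
  let _ : MeasurableSpace (X × Y) := borel (X × Y)
  have : BorelSpace (X × Y) := ⟨rfl⟩
  exact RealRMK.integral_rieszMeasure (iteratedIntegral μ ν)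
    ⟨f, HasCompactSupport.of_compactSpace _⟩

end RadonProduct

/-! ### Cocycles and skew product actions -/

/-- A continuous cocycle of the action of `G` on `K` with values in the topological group `Ω`. -/
structure ContinuousCocycle (G K Ω : Type*) [Semigroup G] [TopologicalSpace G]
    [TopologicalSpace K] [SemigroupAction G K] [Group Ω] [TopologicalSpace Ω] where
  toFun : G → K → Ω
  continuous_toFun : Continuous fun p : G × K => toFun p.1 p.2
  cocycle : ∀ (g₁ g₂ : G) (x : K), toFun (g₁ * g₂) x = toFun g₂ x * toFun g₁ (g₂ • x)

section SkewProduct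

variable {G K Ω : Type*} [Semigroup G] [TopologicalSpace G] [TopologicalSpace K]
  [SemigroupAction G K] [Group Ω] [TopologicalSpace Ω]

/-- A copy of the space `K × Ω`, on which `G` acts by the skew product action of `γ`. -/
def SkewProduct (_γ : ContinuousCocycle G K Ω) : Type _ := K × Ω

namespace SkewProduct

variable (γ : ContinuousCocycle G K Ω)

/-- The product topology. -/
instance : TopologicalSpace (SkewProduct γ) := inferInstanceAs (TopologicalSpace (K × Ω))

/-- The Borel sigma-algebra of the product topology. -/
instance : MeasurableSpace (SkewProduct γ) := borel (K × Ω)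

instance : BorelSpace (SkewProduct γ) := ⟨rfl⟩

/-- The skew product action `g (x, ω) = (g x, ω γ(g, x))`. -/
instance : SemigroupAction G (SkewProduct γ) where
  smul g p := ((g • p.1, p.2 * γ.toFun g p.1) : K × Ω)
  mul_smul g₁ g₂ p := by
    refine Prod.ext (mul_smul g₁ g₂ p.1) ?_
    change p.2 * γ.toFun (g₁ * g₂) p.1 = p.2 * γ.toFun g₂ p.1 * γ.toFun g₁ (g₂ • p.1)
    rw [γ.cocycle, mul_assoc]

theorem smul_def (g : G) (x : K) (ω : Ω) :
    g • (show SkewProduct γ from (x, ω)) = (show SkewProduct γ from (g • x, ω * γ.toFun g x)) := rfl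

instance [ContinuousSMul G K] [ContinuousMul Ω] : ContinuousSMul G (SkewProduct γ) where
  continuous_smul := by
    have h1 : Continuous fun q : G × (K × Ω) => q.1 • q.2.1 := by fun_prop
    have h2 : Continuous fun q : G × (K × Ω) => γ.toFun q.1 q.2.1 :=
      γ.continuous_toFun.comp (by fun_prop : Continuous fun q : G × (K × Ω) => (q.1, q.2.1))
    have h3 : Continuous fun q : G × (K × Ω) => q.2.2 * γ.toFun q.1 q.2.1 := by fun_prop
    exact h1.prodMk h3

/-- The product measure of `μ` and `η` on the space of the skew product action. -/
noncomputable def prodMeasure [CompactSpace K] [T2Space K] [MeasurableSpace K] [BorelSpace K]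
    [CompactSpace Ω] [T2Space Ω] [MeasurableSpace Ω] [BorelSpace Ω]
    (μ : Measure K) [IsFiniteMeasure μ] (η : Measure Ω) [IsFiniteMeasure η] :
    Measure (SkewProduct γ) :=
  (radonProd μ η : @Measure (K × Ω) (borel (K × Ω)))

end SkewProduct

end SkewProduct

/-! The skew product action leaves `μ × η` invariant because `η` is right invariant. For the
uniqueness, let `ν` be an invariant measure on `K × Ω`. Its projection to `K` is invariant, hence
equal to `μ`. The left translations `(x, ω) ↦ (x, a * ω)` commute with the skew product action, so
every translate of `ν` is invariant as well, and the average of the translates with respect to the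
Haar measure `η` is `μ × η`.

An ergodic measure is an extreme point of the invariant measures, in the following form: a finite
invariant measure which is absolutely continuous with respect to it is a multiple of it
(`IsErgodicAction.eq_smul_of_absolutelyContinuous`), since its density is an invariant function.
Applied to the averages of the translates of `ν` over the measurable subsets of `Ω`, this shows that
almost every translate of `ν` is equal to `μ × η`
(`IsErgodicAction.integral_comp_eq_of_integral_integral_eq`). By continuity all of them are, in
particular `ν` itself. -/

/-! ### Regular measures on compact spaces and integrals of continuous functions -/

section RegularMeasure

variable {X Y Z : Type*}
  [TopologicalSpace X] [CompactSpace X] [MeasurableSpace X] [BorelSpace X]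
  [TopologicalSpace Y] [CompactSpace Y] [T2Space Y] [MeasurableSpace Y] [BorelSpace Y]
  [TopologicalSpace Z] [T2Space Z] [MeasurableSpace Z] [BorelSpace Z]

theorem regular_map_of_continuous (μ : Measure X) [μ.Regular] {f : X → Z} (hf : Continuous f) :
    (μ.map f).Regular := by
  have : (μ.map f).InnerRegularCompactLTTop :=
    Measure.InnerRegularCompactLTTop.map_of_continuous hf
  infer_instance

variable [T2Space X]

theorem measure_ext_of_integral_continuousMap {μ ν : Measure X} [μ.Regular] [ν.Regular]
    (h : ∀ f : C(X, ℝ), ∫ x, f x ∂μ = ∫ x, f x ∂ν) : μ = ν :=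
  Measure.ext_of_integral_eq_on_compactlySupported fun f => h f.toContinuousMap

/-- The image under `T` of the product of `μ` and `ν`, characterized by its integrals of continuous
functions. Neither factor has to be regular. -/
theorem exists_regular_integral_eq_integral_integral (μ : Measure X) [IsFiniteMeasure μ]
    (ν : Measure Y) [IsFiniteMeasure ν] (T : C(X × Y, Z)) :
    ∃ P : Measure Z, P.Regular ∧
      ∀ f : C(Z, ℝ), ∫ z, f z ∂P = ∫ x, ∫ y, f (T (x, y)) ∂ν ∂μ := by
  let _ : MeasurableSpace (X × Y) := borel (X × Y)
  have : BorelSpace (X × Y) := ⟨rfl⟩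
  have := radonProd_regular μ ν
  refine ⟨(radonProd μ ν).map T, regular_map_of_continuous _ T.continuous, fun f => ?_⟩
  rw [integral_map T.continuous.aemeasurable f.continuous.aestronglyMeasurable]
  exact integral_radonProd μ ν (f.comp T)

end RegularMeasure

/-! ### Invariant measures and ergodicity -/

section Ergodic

variable {G X : Type*} [SMul G X]

section Measurable

variable [MeasurableSpace X] [MeasurableConstSMul G X]

/-- An ergodic probability measure is minimal, up to multiples, among the finite invariant
measures with respect to absolute continuity. -/
theorem IsErgodicAction.eq_smul_of_absolutelyContinuous {ρ ν : Measure X} [IsProbabilityMeasure ρ]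
    [IsFiniteMeasure ν] [SMulInvariantMeasure G X ρ] [SMulInvariantMeasure G X ν]
    (h : IsErgodicAction G ρ) (hν : ν ≪ ρ) : ν = ν Set.univ • ρ := by
  have hinv : ∀ g : G, ν.rnDeriv ρ ∘ (fun x => g • x) =ᵐ[ρ] ν.rnDeriv ρ := fun g =>
    (measurePreserving_smul g ν).rnDeriv_comp_aeEq (measurePreserving_smul g ρ)
  obtain ⟨c, hc⟩ : ∃ c, ν.rnDeriv ρ =ᵐ[ρ] Function.const X c := by
    refine exists_eventuallyEq_const_of_forall_separating MeasurableSet fun U hU => ?_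
    have hA : ∀ g : G, (fun x => g • x) ⁻¹' (ν.rnDeriv ρ ⁻¹' U) =ᵐ[ρ] ν.rnDeriv ρ ⁻¹' U := by
      intro g
      refine ((hinv g).mono fun x hx => ?_).set_eq
      change ν.rnDeriv ρ (g • x) = ν.rnDeriv ρ x at hx
      simp only [Set.mem_preimage, hx]
    rcases h _ (Measure.measurable_rnDeriv ν ρ hU) hA with h0 | h0
    · exact .inr (measure_eq_zero_iff_ae_notMem.1 h0)
    · exact .inl h0
  have hcν : ν = c • ρ := by
    rw [← withDensity_const]
    change ν = ρ.withDensity (Function.const X c)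
    rw [← withDensity_congr_ae hc, Measure.withDensity_rnDeriv_eq ν ρ hν]
  have : ν Set.univ = c := by rw [hcν]; simp
  rw [this, ← hcν]

end Measurable

variable [TopologicalSpace X] [MeasurableSpace X] [BorelSpace X] [ContinuousConstSMul G X]

theorem integral_comp_smul (P : Measure X) [SMulInvariantMeasure G X P] (g : G) (f : C(X, ℝ)) :
    ∫ x, f (g • x) ∂P = ∫ x, f x ∂P := by
  rw [← (measurePreserving_smul g P).map_eq,
    integral_map (continuous_const_smul g).aemeasurable f.continuous.aestronglyMeasurable,
    (measurePreserving_smul g P).map_eq]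

variable [CompactSpace X] [T2Space X]

theorem smulInvariantMeasure_of_integral_comp_smul (P : Measure X) [P.Regular]
    (h : ∀ (g : G) (f : C(X, ℝ)), ∫ x, f (g • x) ∂P = ∫ x, f x ∂P) :
    SMulInvariantMeasure G X P := by
  refine ⟨fun g s hs => ?_⟩
  have hg : Continuous fun x : X => g • x := continuous_const_smul g
  have := regular_map_of_continuous P hg
  have hmap : P.map (fun x => g • x) = P := measure_ext_of_integral_continuousMap fun f => by
    rw [integral_map hg.aemeasurable f.continuous.aestronglyMeasurable, h]
  rw [← Measure.map_apply hg.measurable hs, hmap]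

/-- If an ergodic measure `ρ` is the average over `a` of the images of an invariant measure `ν`
under a continuous family of maps `T (a, ·)` which commute with the action, then each of these
images is `ρ`. -/
theorem IsErgodicAction.integral_comp_eq_of_integral_integral_eq {A : Type*} [TopologicalSpace A]
    [CompactSpace A] [T2Space A] [MeasurableSpace A] [BorelSpace A] (η : Measure A)
    [IsFiniteMeasure η] [η.IsOpenPosMeasure] {ρ ν : Measure X} [IsProbabilityMeasure ρ] [ρ.Regular]
    [SMulInvariantMeasure G X ρ] [IsProbabilityMeasure ν] [SMulInvariantMeasure G X ν]
    (herg : IsErgodicAction G ρ) (T : C(A × X, X))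
    (hT : ∀ (a : A) (g : G) (x : X), g • T (a, x) = T (a, g • x))
    (havg : ∀ f : C(X, ℝ), ∫ a, ∫ x, f (T (a, x)) ∂ν ∂η = ∫ x, f x ∂ρ) (f : C(X, ℝ)) (a : A) :
    ∫ x, f (T (a, x)) ∂ν = ∫ x, f x ∂ρ := by
  have hcont : ∀ f : C(X, ℝ), Continuous fun a => ∫ x, f (T (a, x)) ∂ν := fun f =>
    continuous_integral_slice ν (f.comp T)
  have hint : ∀ f : C(X, ℝ), Integrable (fun a => ∫ x, f (T (a, x)) ∂ν) η := fun f =>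
    integrable_integral_slice η ν (f.comp T)
  suffices hae : (fun a => ∫ x, f (T (a, x)) ∂ν) =ᵐ[η] fun _ => ∫ x, f x ∂ρ from
    congrFun ((Continuous.ae_eq_iff_eq η (hcont f) continuous_const).1 hae) a
  -- For a measurable `B`, the measure `P B` is the average of the images over `a ∈ B`.
  choose P hPreg hP using fun B : Set A =>
    exists_regular_integral_eq_integral_integral (η.restrict B) ν T
  have hPuniv : ∀ B, (P B).real Set.univ = η.real B := fun B => by
    simpa using hP B 1
  have hPinv : ∀ B, SMulInvariantMeasure G X (P B) := fun B => by
    refine smulInvariantMeasure_of_integral_comp_smul (P B) fun g f => ?_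
    have hg : Continuous fun x : X => g • x := continuous_const_smul g
    rw [hP B f]
    refine (hP B (f.comp ⟨_, hg⟩)).trans (integral_congr_ae (ae_of_all _ fun a => ?_))
    simp only [ContinuousMap.comp_apply, ContinuousMap.coe_mk, hT]
    exact integral_comp_smul ν g (f.comp (T.comp (ContinuousMap.prodMk (.const X a) (.id X))))
  have hPadd : ∀ B, MeasurableSet B → P B + P Bᶜ = ρ := fun B hB => by
    refine measure_ext_of_integral_continuousMap fun f => ?_
    have hi : ∀ B, Integrable f (P B) := fun B =>
      f.continuous.integrable_of_hasCompactSupport (HasCompactSupport.of_compactSpace _)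
    rw [integral_add_measure (hi _) (hi _), hP, hP, integral_add_compl hB (hint f), havg]
  refine Integrable.ae_eq_of_forall_setIntegral_eq _ _ (hint f) (integrable_const _) ?_
  intro B hB _
  have hac : P B ≪ ρ := by
    rw [← hPadd B hB]
    exact Measure.absolutelyContinuous_of_le (Measure.le_add_right le_rfl)
  rw [← hP B f, herg.eq_smul_of_absolutelyContinuous hac, integral_smul_measure,
    ← measureReal_def, hPuniv]
  simp

end Ergodic

/-! ### Unimodularity of compact groups -/

/-- A compact group is unimodular: a right translate of the normalized Haar measure is again a
left invariant probability measure. -/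
theorem isMulRightInvariant_of_compactSpace {Ω : Type*} [Group Ω] [TopologicalSpace Ω]
    [IsTopologicalGroup Ω] [CompactSpace Ω] [MeasurableSpace Ω] [BorelSpace Ω]
    (η : Measure Ω) [η.IsHaarMeasure] [IsProbabilityMeasure η] : η.IsMulRightInvariant := by
  refine ⟨fun g => ?_⟩
  have hg : Continuous fun ω : Ω => ω * g := continuous_mul_const g
  have : IsProbabilityMeasure (η.map (· * g)) :=
    Measure.isProbabilityMeasure_map hg.aemeasurable
  exact Measure.isHaarMeasure_eq_of_isProbabilityMeasure _ _

/-! ### The product measure on the space of a skew product action -/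

namespace SkewProduct

variable {G K Ω : Type*} [Semigroup G] [TopologicalSpace G]
  [TopologicalSpace K] [SemigroupAction G K] [Group Ω] [TopologicalSpace Ω]
  (γ : ContinuousCocycle G K Ω)

/-- The projection to the base. -/
def fst : C(SkewProduct γ, K) := ⟨Prod.fst, continuous_fst⟩

/-- Left translation in the second coordinate. -/
def leftTranslation [ContinuousMul Ω] : C(Ω × SkewProduct γ, SkewProduct γ) where
  toFun p := ((p.2.1, p.1 * p.2.2) : K × Ω)
  continuous_toFun := by
    change Continuous fun p : Ω × (K × Ω) => (p.2.1, p.1 * p.2.2)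
    fun_prop

theorem smul_leftTranslation [ContinuousMul Ω] (a : Ω) (g : G) (p : SkewProduct γ) :
    g • leftTranslation γ (a, p) = leftTranslation γ (a, g • p) :=
  Prod.ext rfl (mul_assoc _ _ _)

variable [CompactSpace K] [T2Space K] [CompactSpace Ω]

instance : CompactSpace (SkewProduct γ) := inferInstanceAs (CompactSpace (K × Ω))

variable [MeasurableSpace K] [BorelSpace K]

theorem isInvariantProbability_map_fst [ContinuousSMul G K] [ContinuousMul Ω]
    {ν : Measure (SkewProduct γ)} (hν : IsInvariantProbability G ν) :
    IsInvariantProbability G (ν.map (fst γ)) := by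
  have := hν.isProbabilityMeasure
  have := hν.regular
  have := hν.invariant
  have hreg := regular_map_of_continuous ν (fst γ).continuous
  refine ⟨Measure.isProbabilityMeasure_map (fst γ).continuous.aemeasurable, hreg,
    smulInvariantMeasure_of_integral_comp_smul _ fun g f => ?_⟩
  have hfg : Continuous fun x : K => f (g • x) := f.continuous.comp (continuous_const_smul g)
  rw [integral_map (fst γ).continuous.aemeasurable hfg.aestronglyMeasurable,
    integral_map (fst γ).continuous.aemeasurable f.continuous.aestronglyMeasurable]
  exact integral_comp_smul ν g (f.comp (fst γ))

variable [T2Space Ω] [MeasurableSpace Ω] [BorelSpace Ω]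
  (μ : Measure K) (η : Measure Ω)

instance : T2Space (SkewProduct γ) := inferInstanceAs (T2Space (K × Ω))

instance [IsFiniteMeasure μ] [IsFiniteMeasure η] : (prodMeasure γ μ η).Regular :=
  radonProd_regular μ η

theorem integral_prodMeasure [IsFiniteMeasure μ] [IsFiniteMeasure η] (f : C(SkewProduct γ, ℝ)) :
    ∫ p, f p ∂prodMeasure γ μ η = ∫ x, ∫ ω, f ((x, ω) : K × Ω) ∂η ∂μ :=
  integral_radonProd μ η f

instance [IsProbabilityMeasure μ] [IsProbabilityMeasure η] :
    IsProbabilityMeasure (prodMeasure γ μ η) := by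
  have h : ∫ _, (1 : ℝ) ∂prodMeasure γ μ η = ∫ _, ∫ _, (1 : ℝ) ∂η ∂μ :=
    integral_prodMeasure γ μ η 1
  simp only [integral_const, probReal_univ, smul_eq_mul, mul_one] at h
  exact ⟨(ENNReal.toReal_eq_one_iff _).1 h⟩

/-- The fibre integral of a continuous function, as a continuous function on `K`. -/
noncomputable def fibreIntegral [IsFiniteMeasure η] (f : C(SkewProduct γ, ℝ)) : C(K, ℝ) where
  toFun x := ∫ ω, f ((x, ω) : K × Ω) ∂η
  continuous_toFun := continuous_integral_slice (X := K) (Y := Ω) η f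

instance smulInvariantMeasure_prodMeasure [ContinuousSMul G K] [IsTopologicalGroup Ω]
    [IsFiniteMeasure μ] [IsFiniteMeasure η] [SMulInvariantMeasure G K μ]
    [η.IsMulRightInvariant] : SMulInvariantMeasure G (SkewProduct γ) (prodMeasure γ μ η) := by
  refine smulInvariantMeasure_of_integral_comp_smul _ fun g f => ?_
  rw [integral_prodMeasure]
  have hg : Continuous fun p : SkewProduct γ => g • p := continuous_const_smul g
  refine (integral_prodMeasure γ μ η (f.comp ⟨_, hg⟩)).trans ?_
  refine Eq.trans (integral_congr_ae (ae_of_all _ fun x => ?_))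
    (integral_comp_smul μ g (fibreIntegral γ η f))
  exact integral_mul_right_eq_self (fun ω => f ((g • x, ω) : K × Ω)) (γ.toFun g x)

/-- The average of the left translates of a measure is the product of its projection to `K` with the
Haar measure. -/
theorem integral_integral_leftTranslation [ContinuousMul Ω] [IsFiniteMeasure η]
    [IsFiniteMeasure μ] [η.IsMulRightInvariant] {ν : Measure (SkewProduct γ)} [IsFiniteMeasure ν]
    (hν : ν.map (fst γ) = μ) (f : C(SkewProduct γ, ℝ)) :
    ∫ a, ∫ p, f (leftTranslation γ (a, p)) ∂ν ∂η = ∫ p, f p ∂prodMeasure γ μ η := by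
  have hcomp : Continuous (Function.uncurry fun a p => f (leftTranslation γ (a, p))) :=
    (f.comp (leftTranslation γ)).continuous
  -- Fubini for continuous functions; the Borel sets of `Ω × (K × Ω)` need not be product measurable.
  rw [integral_integral_swap_of_hasCompactSupport hcomp (HasCompactSupport.of_compactSpace _),
    integral_prodMeasure]
  refine Eq.trans (integral_congr_ae (ae_of_all _ fun p => ?_)) (Eq.trans
    (integral_map (fst γ).continuous.aemeasurable
      (fibreIntegral γ η f).continuous.aestronglyMeasurable).symm (by rw [hν]; rfl))
  exact integral_mul_right_eq_self (fun ω => f ((p.1, ω) : K × Ω)) p.2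

end SkewProduct

/-! ### Unique ergodicity of ergodic skew products -/

theorem mainTheorem6
    {G : Type*} [Semigroup G] [TopologicalSpace G] [SeparatelyContinuousMul G]
    (hG : IsRightAmenable G)
    {K : Type*} [TopologicalSpace K] [CompactSpace K] [T2Space K]
    [MeasurableSpace K] [BorelSpace K]
    [SemigroupAction G K] [ContinuousSMul G K]
    (μ : Measure K) [IsProbabilityMeasure μ] (hμ : IsUniquelyErgodic G μ)
    {Ω : Type*} [Group Ω] [TopologicalSpace Ω] [IsTopologicalGroup Ω]
    [CompactSpace Ω] [T2Space Ω] [MeasurableSpace Ω] [BorelSpace Ω]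
    (η : Measure Ω) [η.IsHaarMeasure] [η.Regular] [IsProbabilityMeasure η]
    (γ : ContinuousCocycle G K Ω)
    (herg : IsErgodicAction G (SkewProduct.prodMeasure γ μ η)) :
    IsUniquelyErgodic G (SkewProduct.prodMeasure γ μ η) := by
  have := isMulRightInvariant_of_compactSpace η
  have := hμ.isInvariantProbability.invariant
  refine ⟨⟨inferInstance, inferInstance, inferInstance⟩, fun ν hν => ?_⟩
  have := hν.isProbabilityMeasure
  have := hν.regular
  have := hν.invariant
  have hfst := hμ.unique _ (SkewProduct.isInvariantProbability_map_fst γ hν)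
  refine measure_ext_of_integral_continuousMap fun f => ?_
  have h := herg.integral_comp_eq_of_integral_integral_eq η (SkewProduct.leftTranslation γ)
    (SkewProduct.smul_leftTranslation γ)
    (SkewProduct.integral_integral_leftTranslation γ μ η hfst) f 1
  have hone : ∀ p : SkewProduct γ, SkewProduct.leftTranslation γ (1, p) = p := fun p =>
    Prod.ext rfl (one_mul _)
  simpa only [hone] using h
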